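/- Let $d\in\mathbb N$, let $\mathbb R^d$ carry the Euclidean norm, and let $\alpha\in(0,1]$, $\ell\in\mathbb R$, $\beta\ge 0$. Let $f:\mathbb R^d\to\mathbb R$ be of class $C^2$ with $\langle\nabla^2 f(x)v,v\rangle\ge m_f\|v\|^2$ for all $x,v\in\mathbb R^d$, where $m_f>0$, and let $y_*$ be the stationary point of $f$, i.e. $\nabla f(y_*)=0$. Let $\psi:[\ell,\infty)\to\mathbb R$ be of class $C^1$ with $\psi'>0$ (one-sided derivative at $\ell$). For a scalar function $x$ on $[\ell,\infty)$ put $I^{\nu}_{\ell,\psi}x(t)=\frac1{\Gamma(\nu)}\int_\ell^t(\psi(t)-\psi(\tau))^{\nu-1}\psi'(\tau)x(\tau)\,d\tau$ for $\nu>0$, let $I^0_{\ell,\psi}$ be the identity, and define the $\psi$-Caputo derivative of order $\alpha$ by ${}^C\!D^\alpha_{\ell,\psi}x=I^{1-\alpha}_{\ell,\psi}\bigl(x'/\psi'\bigr)$; for vector functions it is taken componentwise. Let $E_\alpha(x)=\sum_{j\ge0}\frac{x^j}{\Gamma(j\alpha+1)}$ be the Mittag-Leffler function. Let $z:[\ell,\infty)\to\mathbb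 R^d$ be a solution of $${}^C\!D^\alpha_{\ell,\psi}z(t)=-\beta\nabla f(z(t))\quad(t>\ell),\qquad z(\ell)=z_0,$$ that is, $z$ is locally absolutely continuous on $[\ell,\infty)$, its $\psi$-Caputo derivative is well defined at every $t>\ell$ (for $\alpha=1$: $z$ is differentiable at $t$; for $\alpha<1$: the integral defining it converges absolutely), and the two equations hold. Then: 1. For all $t\ge\ell$, $$\|z(t)-y_*\|^2\le\|z_0-y_*\|^2\,E_\alpha\bigl(-\beta m_f(\psi(t)-\psi(\ell))^\alpha\bigr).$$ 2. If in addition $\nabla f$ is Lipschitz continuous with constant $M_f$, then for all $t\ge\ell$, $$f(z(t))-f(y_*)\le\tfrac12 M_f\,\|z_0-y_*\|^2\,E_\alpha\bigl(-\beta m_f(\psi(t)-\psi(\ell))^\alpha\bigr).$$ -/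

import Mathlib

open MeasureTheory Set

namespace PsiFractional

noncomputable section

/-- The operator `J_ψ = (1 / ψ') d/dt` applied to a scalar function on `[ℓ, ∞)`. Derivatives are
taken within `[ℓ, ∞)`, so that values to the left of `ℓ` play no role. -/
def psiJ (ψ : ℝ → ℝ) (ℓ : ℝ) (x : ℝ → ℝ) (t : ℝ) : ℝ :=
  (derivWithin ψ (Ici ℓ) t)⁻¹ * derivWithin x (Ici ℓ) t

/-- The integrand `τ ↦ (ψ(t) - ψ(τ))^(ν - 1) ψ'(τ) x(τ)` of the `ψ`-Riemann-Liouville integral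
of order `ν`. -/
def psiKernel (ψ : ℝ → ℝ) (ℓ ν : ℝ) (x : ℝ → ℝ) (t τ : ℝ) : ℝ :=
  (ψ t - ψ τ) ^ (ν - 1) * derivWithin ψ (Ici ℓ) τ * x τ

open Classical in
/-- The `ψ`-Riemann-Liouville integral `I_{ℓ,ψ}^ν x` of order `ν ≥ 0` based at `ℓ`; the integral of
order zero is the identity. -/
def psiIntegral (ψ : ℝ → ℝ) (ℓ ν : ℝ) (x : ℝ → ℝ) (t : ℝ) : ℝ :=
  if ν = 0 then x t else (Real.Gamma ν)⁻¹ * ∫ τ in ℓ..t, psiKernel ψ ℓ ν x t τ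

/-- The `ψ`-Caputo derivative `I_{ℓ,ψ}^(1-α) ∘ J_ψ` of order `0 < α ≤ 1` of a scalar function. -/
def psiCaputo (ψ : ℝ → ℝ) (ℓ α : ℝ) (x : ℝ → ℝ) (t : ℝ) : ℝ :=
  psiIntegral ψ ℓ (1 - α) (psiJ ψ ℓ x) t

/-- The `ψ`-Caputo derivative of a vector function, taken componentwise. -/
def psiCaputoVec {d : ℕ} (ψ : ℝ → ℝ) (ℓ α : ℝ) (x : ℝ → EuclideanSpace ℝ (Fin d)) (t : ℝ) :
    EuclideanSpace ℝ (Fin d) :=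
  WithLp.toLp 2 fun i => psiCaputo ψ ℓ α (fun s => x s i) t

/-- The defining expression of the `ψ`-Caputo derivative of order `α` makes sense at `t` for the
scalar function `x`: for `α = 1` this is differentiability at `t`, for `α ≠ 1` it is integrability
over `[ℓ, t]` of `(ψ(t) - ψ(τ))^(-α) ψ'(τ) (J_ψ x)(τ)`. -/
def PsiCaputoExistsAt (ψ : ℝ → ℝ) (ℓ α : ℝ) (x : ℝ → ℝ) (t : ℝ) : Prop :=
  (α = 1 → DifferentiableWithinAt ℝ x (Ici ℓ) t) ∧
  (α ≠ 1 → IntervalIntegrable (psiKernel ψ ℓ (1 - α) (psiJ ψ ℓ x) t) volume ℓ t)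

/-- `z` solves `ᶜD_{ℓ,ψ}^α z(t) = g(z(t))`, `t > ℓ`, with `z(ℓ) = z₀`. The function `z` is locally
absolutely continuous on `[ℓ, ∞)` (in particular continuous there, and differentiable almost
everywhere), and its `ψ`-Caputo derivative exists at every `t > ℓ`. -/
structure IsCaputoSolution {d : ℕ} (ψ : ℝ → ℝ) (ℓ α : ℝ)
    (g : EuclideanSpace ℝ (Fin d) → EuclideanSpace ℝ (Fin d)) (z₀ : EuclideanSpace ℝ (Fin d))
    (z : ℝ → EuclideanSpace ℝ (Fin d)) : Prop where
  absolutelyContinuous : ∀ T, ℓ ≤ T → AbsolutelyContinuousOnInterval z ℓ T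
  existsAt : ∀ t, ℓ < t → ∀ i, PsiCaputoExistsAt ψ ℓ α (fun s => z s i) t
  equation : ∀ t, ℓ < t → psiCaputoVec ψ ℓ α z t = g (z t)
  initial : z ℓ = z₀

/-- The Mittag-Leffler function `E_α(x) = ∑ⱼ xʲ / Γ(jα + 1)` at real arguments; for `α > 0` the
series converges absolutely for every `x`. -/
def mittagLeffler (α x : ℝ) : ℝ :=
  ∑' j : ℕ, x ^ j / Real.Gamma (j * α + 1)

/-- The Hessian `∇²f(x)`, as the linear map `v ↦ ∇²f(x) v`: the derivative of the gradient. -/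
def hessian {d : ℕ} (f : EuclideanSpace ℝ (Fin d) → ℝ) (x : EuclideanSpace ℝ (Fin d)) :
    EuclideanSpace ℝ (Fin d) →L[ℝ] EuclideanSpace ℝ (Fin d) :=
  fderiv ℝ (gradient f) x

end

end PsiFractional

/-! Put `V = ‖z - y‖²`. The Hessian bound gives `⟪x - y, ∇f x⟫ ≥ m ‖x - y‖²`, and Alikhanov's
inequality `D^α(u²) ≤ 2 u D^α u`, summed over components, then gives `D^α V ≤ -2βm V ≤ -βm V`. The
function `w = V(ℓ) E_α(-βm (ψ - ψ ℓ)^α)` satisfies `D^α w = -βm w` and `w(ℓ) = V(ℓ)`, so it remains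
to compare `V` with `w`: at a positive maximum of `V - w` the fractional derivative would be
positive by the extremum principle, yet at most `-βm (V - w) ≤ 0`.

Alikhanov's inequality and the extremum principle both follow from
`integral_mul_deriv_le_neg_of_nonneg`, applied to `(u t - u)²` and to `u t - u` respectively. The
equation for `w` comes from termwise Beta integrals after the change of time `s = ψ τ - ψ ℓ`. For `α
= 1` the kernel disappears and a Gronwall argument replaces the comparison. The bound on `f` follows
from the bound on `V` by the descent lemma. -/

namespace PsiFractional

open Filter Topology

/-! ### Inequalities for monotone singular kernels -/

/-- Integration by parts against a nonnegative increasing kernel `k` on `[a, t)`, possibly singular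
at `t`: a nonnegative `g` vanishing at `t` satisfies `∫ k g' ≤ -k(a) g(a)`. The boundary term at `t`
vanishes because `k(b) g(b) ≤ ∫_b^t |k g'|`. -/
theorem integral_mul_deriv_le_neg_of_nonneg {k g : ℝ → ℝ} {a t : ℝ} (hat : a < t)
    (hk : ∀ b ∈ Ioo a t, AbsolutelyContinuousOnInterval k a b)
    (hk_mono : MonotoneOn k (Ico a t)) (hk_nonneg : ∀ x ∈ Ico a t, 0 ≤ k x)
    (hg : AbsolutelyContinuousOnInterval g a t) (hg_nonneg : ∀ x ∈ Icc a t, 0 ≤ g x)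
    (hgt : g t = 0) (hint : IntervalIntegrable (fun x => k x * deriv g x) volume a t) :
    ∫ x in a..t, k x * deriv g x ≤ -(k a * g a) := by
  set F : ℝ → ℝ := fun b => ∫ x in a..b, k x * deriv g x with hF
  have hsub : ∀ {b}, b ∈ Ioo a t → uIcc a b ⊆ uIcc a t := fun {b} hb => by
    rw [uIcc_of_le hb.1.le, uIcc_of_le hat.le]; exact Icc_subset_Icc_right hb.2.le
  have hsub' : ∀ {b}, b ∈ Ioo a t → uIcc b t ⊆ uIcc a t := fun {b} hb => by
    rw [uIcc_of_le hb.2.le, uIcc_of_le hat.le]; exact Icc_subset_Icc_left hb.1.le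
  have hparts : ∀ b ∈ Ioo a t, F b ≤ k b * g b - k a * g a := by
    intro b hb
    have h := (hk b hb).integral_mul_deriv_eq_deriv_mul (hg.mono (hsub hb))
    have hpos : 0 ≤ ∫ x in a..b, deriv k x * g x := by
      rw [intervalIntegral.integral_of_le hb.1.le, integral_Ioc_eq_integral_Ioo]
      refine setIntegral_nonneg measurableSet_Ioo fun x hx => mul_nonneg ?_ ?_
      · have hmem : Ico a t ∈ 𝓝 x := Ico_mem_nhds hx.1 (hx.2.trans hb.2)
        rw [← derivWithin_of_mem_nhds hmem]
        exact hk_mono.derivWithin_nonneg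
      · exact hg_nonneg x ⟨hx.1.le, (hx.2.trans hb.2).le⟩
    simp only [hF]
    linarith
  have hbdry : ∀ b ∈ Ioo a t, k b * g b ≤ ∫ x in b..t, |k x * deriv g x| := by
    intro b hb
    have hgb := (hg.mono (hsub' hb)).integral_deriv_eq_sub
    have hi : IntervalIntegrable (fun x => k x * deriv g x) volume b t := hint.mono_set (hsub' hb)
    calc k b * g b = ∫ x in b..t, -(k b * deriv g x) := by
          rw [intervalIntegral.integral_neg, intervalIntegral.integral_const_mul, hgb, hgt]; ring
      _ ≤ ∫ x in b..t, |k x * deriv g x| := by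
          refine intervalIntegral.integral_mono_on_of_le_Ioo hb.2.le
            ((hg.mono (hsub' hb)).intervalIntegrable_deriv.const_mul _).neg hi.abs fun x hx => ?_
          have hkb := hk_nonneg b ⟨hb.1.le, hb.2⟩
          have hkx := hk_mono ⟨hb.1.le, hb.2⟩ ⟨(hb.1.trans hx.1).le, hx.2⟩ hx.1.le
          rw [abs_mul, abs_of_nonneg (hkb.trans hkx)]
          calc -(k b * deriv g x) ≤ k b * |deriv g x| := by
                rw [← mul_neg]; exact mul_le_mul_of_nonneg_left (neg_le_abs _) hkb
            _ ≤ _ := mul_le_mul_of_nonneg_right hkx (abs_nonneg _)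
  have htend : ∀ {h : ℝ → ℝ}, IntervalIntegrable h volume a t →
      Tendsto (fun b => ∫ x in a..b, h x) (𝓝[<] t) (𝓝 (∫ x in a..t, h x)) := by
    intro h hh
    have hc := intervalIntegral.continuousOn_primitive_interval' hh left_mem_uIcc t right_mem_uIcc
    rw [uIcc_of_le hat.le] at hc
    rw [← nhdsWithin_Ioo_eq_nhdsLT hat]
    exact hc.mono_left (nhdsWithin_mono _ Ioo_subset_Icc_self)
  have hlim : Tendsto (fun b => ((∫ x in a..t, |k x * deriv g x|) -
      ∫ x in a..b, |k x * deriv g x|) - k a * g a) (𝓝[<] t) (𝓝 (0 - k a * g a)) := by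
    refine Tendsto.sub_const ?_ _
    simpa using (htend hint.abs).const_sub (∫ x in a..t, |k x * deriv g x|)
  rw [← zero_sub]
  refine le_of_tendsto_of_tendsto (htend hint) hlim ?_
  filter_upwards [Ioo_mem_nhdsLT hat] with b hb
  have h1 := hparts b hb
  have h2 := hbdry b hb
  have h3 := intervalIntegral.integral_add_adjacent_intervals (hint.abs.mono_set (hsub hb))
    (hint.abs.mono_set (hsub' hb))
  simp only [hF] at h1
  linarith

/-- The extremum principle at a maximum attained at the right endpoint. -/
theorem mul_sub_le_integral_mul_deriv_of_isMax {k u : ℝ → ℝ} {a t : ℝ} (hat : a < t)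
    (hk : ∀ b ∈ Ioo a t, AbsolutelyContinuousOnInterval k a b)
    (hk_mono : MonotoneOn k (Ico a t)) (hk_nonneg : ∀ x ∈ Ico a t, 0 ≤ k x)
    (hu : AbsolutelyContinuousOnInterval u a t) (hmax : ∀ x ∈ Icc a t, u x ≤ u t)
    (hint : IntervalIntegrable (fun x => k x * deriv u x) volume a t) :
    k a * (u t - u a) ≤ ∫ x in a..t, k x * deriv u x := by
  have hconst : AbsolutelyContinuousOnInterval (fun _ : ℝ => u t) a t :=
    contDiffOn_const.absolutelyContinuousOnInterval
  have h := integral_mul_deriv_le_neg_of_nonneg (g := fun x => u t - u x) hat hk hk_mono hk_nonneg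
    (hconst.fun_sub hu) (fun x hx => sub_nonneg.2 (hmax x hx)) (sub_self _)
    (by simp only [deriv_const_sub, mul_neg]; exact hint.neg)
  simp only [deriv_const_sub, mul_neg, intervalIntegral.integral_neg] at h
  linarith

theorem ae_deriv_sq {u : ℝ → ℝ} {a b : ℝ} (hu : AbsolutelyContinuousOnInterval u a b) (c : ℝ) :
    ∀ᵐ x, x ∈ uIcc a b → deriv (fun y => (c - u y) ^ 2) x = -(2 * (c - u x) * deriv u x) := by
  filter_upwards [hu.ae_differentiableAt] with x hx hmem
  have h := ((hx hmem).hasDerivAt.const_sub c).fun_pow 2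
  rw [h.deriv]
  push_cast
  ring

/-- Alikhanov's inequality for a nonnegative increasing kernel. -/
theorem integral_mul_deriv_sq_le {k u : ℝ → ℝ} {a t : ℝ} (hat : a < t)
    (hk : ∀ b ∈ Ioo a t, AbsolutelyContinuousOnInterval k a b)
    (hk_mono : MonotoneOn k (Ico a t)) (hk_nonneg : ∀ x ∈ Ico a t, 0 ≤ k x)
    (hu : AbsolutelyContinuousOnInterval u a t)
    (hint : IntervalIntegrable (fun x => k x * deriv u x) volume a t) :
    IntervalIntegrable (fun x => k x * deriv (fun y => u y ^ 2) x) volume a t ∧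
    ∫ x in a..t, k x * deriv (fun y => u y ^ 2) x ≤
      2 * u t * ∫ x in a..t, k x * deriv u x := by
  have hconst : AbsolutelyContinuousOnInterval (fun _ : ℝ => u t) a t :=
    contDiffOn_const.absolutelyContinuousOnInterval
  have hac : AbsolutelyContinuousOnInterval (fun x => (u t - u x) ^ 2) a t := by
    simpa only [sq] using (hconst.fun_sub hu).fun_mul (hconst.fun_sub hu)
  have hmul : IntervalIntegrable (fun x => u x * (k x * deriv u x)) volume a t :=
    hint.continuousOn_mul hu.continuousOn
  have hsq : ∀ᵐ x, x ∈ uIoc a t →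
      2 * (u x * (k x * deriv u x)) = k x * deriv (fun y => u y ^ 2) x := by
    filter_upwards [ae_deriv_sq hu 0] with x hx hmem
    have := hx (uIoc_subset_uIcc hmem)
    simp only [zero_sub, neg_sq] at this
    rw [this]; ring
  -- The two sides of Alikhanov's inequality differ by the integral of `k g'` with `g = (u t - u)²`,
  -- which is nonnegative and vanishes at `t`.
  have hdiff : ∀ᵐ x, x ∈ uIoc a t →
      2 * (u x * (k x * deriv u x)) - 2 * u t * (k x * deriv u x) =
        k x * deriv (fun y => (u t - u y) ^ 2) x := by
    filter_upwards [ae_deriv_sq hu (u t)] with x hx hmem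
    rw [hx (uIoc_subset_uIcc hmem)]; ring
  have hi2 := (hmul.const_mul 2).sub (hint.const_mul (2 * u t))
  have h := integral_mul_deriv_le_neg_of_nonneg (g := fun x => (u t - u x) ^ 2) hat hk hk_mono
    hk_nonneg hac (fun x _ => sq_nonneg _) (by simp)
    (hi2.congr_ae ((ae_restrict_iff' measurableSet_uIoc).2 hdiff))
  rw [← intervalIntegral.integral_congr_ae hdiff, intervalIntegral.integral_sub (hmul.const_mul 2)
    (hint.const_mul (2 * u t)), intervalIntegral.integral_congr_ae hsq,
    intervalIntegral.integral_const_mul] at h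
  refine ⟨(hmul.const_mul 2).congr_ae ((ae_restrict_iff' measurableSet_uIoc).2 hsq), ?_⟩
  have := mul_nonneg (hk_nonneg a ⟨le_rfl, hat⟩) (sq_nonneg (u t - u a))
  linarith

/-! ### Mittag-Leffler series and Beta integrals -/

/-- Keep only the part of the Gamma integral over `(R, ∞)`, where `x ^ y ≥ R ^ y`. As `R` is free,
`Γ` outgrows every geometric sequence. -/
theorem rpow_mul_exp_neg_le_Gamma_add_one {R y : ℝ} (hR : 0 < R) (hy : 0 ≤ y) :
    R ^ y * Real.exp (-R) ≤ Real.Gamma (y + 1) := by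
  have hconv := Real.GammaIntegral_convergent (by linarith : 0 < y + 1)
  rw [Real.Gamma_eq_integral (by linarith)]
  calc R ^ y * Real.exp (-R) = ∫ x in Ioi R, R ^ y * Real.exp (-x) := by
        rw [integral_const_mul, integral_exp_neg_Ioi]
    _ ≤ ∫ x in Ioi R, Real.exp (-x) * x ^ (y + 1 - 1) := by
        refine setIntegral_mono_on ((integrableOn_exp_neg_Ioi R).const_mul _)
          (hconv.mono_set (Ioi_subset_Ioi hR.le)) measurableSet_Ioi fun x hx => ?_
        rw [mul_comm, add_sub_cancel_right]
        exact mul_le_mul_of_nonneg_left (Real.rpow_le_rpow hR.le (le_of_lt hx) hy)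
          (Real.exp_pos _).le
    _ ≤ _ := setIntegral_mono_set hconv
        ((ae_restrict_iff' measurableSet_Ioi).2 (ae_of_all _ fun x hx =>
          mul_nonneg (Real.exp_pos _).le (Real.rpow_nonneg (le_of_lt hx) _)))
        (Ioi_subset_Ioi hR.le).eventuallyLE

theorem summable_pow_div_Gamma {α δ : ℝ} (hα : 0 < α) (hδ : 0 < δ) (x : ℝ) :
    Summable fun j : ℕ => x ^ j / Real.Gamma (j * α + δ) := by
  -- `R ^ α = Q ≥ 2|x|` makes the `j`-th term at most a constant times `(jα + δ) 2⁻ʲ`; the linear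
  -- factor comes from `Γ(y + 1) = y Γ(y)`.
  set Q : ℝ := 2 * (|x| + 1) with hQ
  have hQ0 : 0 < Q := by positivity
  set R : ℝ := Q ^ α⁻¹ with hR
  have hR0 : 0 < R := Real.rpow_pos_of_pos hQ0 _
  have hRα : R ^ α = Q := by rw [hR, ← Real.rpow_mul hQ0.le, inv_mul_cancel₀ hα.ne', Real.rpow_one]
  have hgeom : Summable fun j : ℕ => (j * α + δ) * (Real.exp R * (R ^ δ)⁻¹) * (1 / 2 : ℝ) ^ j := by
    have h1 : Summable fun j : ℕ => (j : ℝ) ^ 1 * (1 / 2 : ℝ) ^ j :=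
      summable_pow_mul_geometric_of_norm_lt_one 1 (by norm_num)
    have h2 : Summable fun j : ℕ => (1 / 2 : ℝ) ^ j := summable_geometric_two
    refine ((h1.mul_left (α * (Real.exp R * (R ^ δ)⁻¹))).add
      (h2.mul_left (δ * (Real.exp R * (R ^ δ)⁻¹)))).congr fun j => ?_
    ring
  refine Summable.of_norm_bounded hgeom fun j => ?_
  have hy : 0 < j * α + δ := by positivity
  have hΓ := rpow_mul_exp_neg_le_Gamma_add_one hR0 hy.le
  rw [Real.Gamma_add_one hy.ne', Real.rpow_add hR0, mul_comm (j : ℝ) α, Real.rpow_mul hR0.le, hRα,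
    Real.rpow_natCast, mul_comm α] at hΓ
  rw [norm_div, norm_pow, Real.norm_eq_abs, Real.norm_of_nonneg (Real.Gamma_pos_of_pos hy).le,
    div_le_iff₀ (Real.Gamma_pos_of_pos hy)]
  have hx : |x| ^ j ≤ (1 / 2) ^ j * Q ^ j := by
    rw [← mul_pow]
    exact pow_le_pow_left₀ (abs_nonneg _) (by rw [hQ]; linarith) _
  calc |x| ^ j ≤ (1 / 2) ^ j * Q ^ j := hx
    _ = (Real.exp R * (R ^ δ)⁻¹) * (1 / 2) ^ j * (Q ^ j * R ^ δ * Real.exp (-R)) := by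
        rw [Real.exp_neg]
        have := (Real.exp_pos R).ne'
        have := (Real.rpow_pos_of_pos hR0 δ).ne'
        field_simp
    _ ≤ (Real.exp R * (R ^ δ)⁻¹) * (1 / 2) ^ j * ((j * α + δ) * Real.Gamma (j * α + δ)) :=
        mul_le_mul_of_nonneg_left hΓ (by positivity)
    _ = _ := by ring

theorem integral_sub_rpow_mul_rpow {S μ ν : ℝ} (hS : 0 < S) (hμ : 0 < μ) (hν : 0 < ν) :
    ∫ s in (0 : ℝ)..S, (S - s) ^ (ν - 1) * s ^ (μ - 1) =
      S ^ (μ + ν - 1) * (Real.Gamma μ * Real.Gamma ν / Real.Gamma (μ + ν)) := by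
  have hB := Complex.betaIntegral_scaled μ ν hS
  rw [Complex.betaIntegral_eq_Gamma_mul_div _ _ (by simpa) (by simpa)] at hB
  apply Complex.ofReal_injective
  rw [← intervalIntegral.integral_ofReal]
  push_cast
  rw [← Complex.Gamma_ofReal, ← Complex.Gamma_ofReal, ← Complex.Gamma_ofReal,
    Complex.ofReal_cpow hS.le]
  push_cast
  rw [← hB]
  refine intervalIntegral.integral_congr fun s hs => ?_
  rw [uIcc_of_le hS.le] at hs
  rw [mul_comm, Complex.ofReal_cpow hs.1, Complex.ofReal_cpow (sub_nonneg.2 hs.2)]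
  push_cast
  rfl

/-- The integral of a non-integrable function is `0` by convention, while the Beta value is
positive. -/
theorem intervalIntegrable_sub_rpow_mul_rpow {S μ ν : ℝ} (hS : 0 < S) (hμ : 0 < μ) (hν : 0 < ν) :
    IntervalIntegrable (fun s => (S - s) ^ (ν - 1) * s ^ (μ - 1)) volume 0 S := by
  by_contra h
  have h0 := intervalIntegral.integral_undef h
  rw [integral_sub_rpow_mul_rpow hS hμ hν] at h0
  have := Real.Gamma_pos_of_pos hμ
  have := Real.Gamma_pos_of_pos hν
  have := Real.Gamma_pos_of_pos (add_pos hμ hν)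
  have := Real.rpow_pos_of_pos hS (μ + ν - 1)
  exact absurd h0 (by positivity)

theorem integrable_tsum_of_summable_integral_norm {X : Type*} [MeasurableSpace X] {μ : Measure X}
    {F : ℕ → X → ℝ} (hF_meas : ∀ i, Measurable (F i)) (hF_int : ∀ i, Integrable (F i) μ)
    (hF_sum : Summable fun i => ∫ a, ‖F i a‖ ∂μ) : Integrable (fun a => ∑' i, F i a) μ := by
  refine ⟨(Measurable.tsum hF_meas).aestronglyMeasurable, ?_⟩
  rw [hasFiniteIntegral_iff_enorm]
  have hle : ∀ a, ‖∑' i, F i a‖ₑ ≤ ∑' i, ‖F i a‖ₑ := fun a =>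
    enorm_tsum_le_tsum_enorm
  refine (lintegral_mono hle).trans_lt ?_
  rw [lintegral_tsum fun i => (hF_meas i).enorm.aemeasurable]
  have : ∀ i, ∫⁻ a, ‖F i a‖ₑ ∂μ = ENNReal.ofReal (∫ a, ‖F i a‖ ∂μ) := fun i =>
    (ofReal_integral_norm_eq_lintegral_enorm (hF_int i)).symm
  simp_rw [this]
  rw [← ENNReal.ofReal_tsum_of_nonneg (fun i => integral_nonneg fun a => norm_nonneg _) hF_sum]
  exact ENNReal.ofReal_lt_top

/-- The formal derivative of `s ↦ E_α(c s^α)`. -/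
noncomputable def mittagLefflerDeriv (α c s : ℝ) : ℝ :=
  ∑' j : ℕ, c ^ (j + 1) / Real.Gamma ((j + 1) * α) * s ^ ((j + 1) * α - 1)

/-- Each term is a Beta integral whose `Γ((j + 1)α)` cancels the coefficient. The case `ν = 1`
recovers `E_α`, and `ν = 1 - α` its fractional derivative. -/
theorem integral_sub_rpow_mul_mittagLefflerDeriv {α ν S : ℝ} (hα : 0 < α) (hν : 0 < ν) (hS : 0 < S)
    (c : ℝ) :
    IntervalIntegrable (fun s => (S - s) ^ (ν - 1) * mittagLefflerDeriv α c s) volume 0 S ∧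
    ∫ s in (0 : ℝ)..S, (S - s) ^ (ν - 1) * mittagLefflerDeriv α c s =
      ∑' j : ℕ, c ^ (j + 1) * S ^ ((j + 1) * α + ν - 1) * Real.Gamma ν /
        Real.Gamma ((j + 1) * α + ν) := by
  set F : ℕ → ℝ → ℝ := fun j s =>
    c ^ (j + 1) / Real.Gamma ((j + 1) * α) * ((S - s) ^ (ν - 1) * s ^ ((j + 1) * α - 1)) with hF
  have hμ : ∀ j : ℕ, 0 < ((j : ℝ) + 1) * α := fun j => by positivity
  have hFsum : (fun s => (S - s) ^ (ν - 1) * mittagLefflerDeriv α c s) = fun s => ∑' j, F j s := by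
    funext s
    rw [mittagLefflerDeriv, ← tsum_mul_left]
    exact tsum_congr fun j => by simp only [hF]; ring
  have hmeas : ∀ j, Measurable (F j) := fun j => by simp only [hF]; fun_prop
  have hint : ∀ j, IntegrableOn (F j) (Ioc 0 S) := fun j =>
    (intervalIntegrable_iff_integrableOn_Ioc_of_le hS.le).1
      ((intervalIntegrable_sub_rpow_mul_rpow hS (hμ j) hν).const_mul _)
  have hval : ∀ j, ∫ s in Ioc 0 S, F j s = c ^ (j + 1) * S ^ ((j + 1) * α + ν - 1) * Real.Gamma ν /
        Real.Gamma ((j + 1) * α + ν) := fun j => by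
    rw [← intervalIntegral.integral_of_le hS.le, intervalIntegral.integral_const_mul,
      integral_sub_rpow_mul_rpow hS (hμ j) hν]
    have := (Real.Gamma_pos_of_pos (hμ j)).ne'
    field_simp
  have hnorm : ∀ j, ∫ s in Ioc 0 S, ‖F j s‖ = |c| ^ (j + 1) * S ^ ((j + 1) * α + ν - 1) *
      Real.Gamma ν / Real.Gamma ((j + 1) * α + ν) := fun j => by
    have hΓ := Real.Gamma_pos_of_pos (hμ j)
    have : ∀ s ∈ Ioc 0 S, ‖F j s‖ = |c| ^ (j + 1) / Real.Gamma ((j + 1) * α) *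
        ((S - s) ^ (ν - 1) * s ^ ((j + 1) * α - 1)) := fun s hs => by
      simp only [hF]
      rw [norm_mul, norm_div, norm_pow, Real.norm_eq_abs, Real.norm_of_nonneg hΓ.le,
        Real.norm_of_nonneg (mul_nonneg (Real.rpow_nonneg (sub_nonneg.2 hs.2) _)
          (Real.rpow_nonneg hs.1.le _))]
    rw [setIntegral_congr_fun measurableSet_Ioc this,
      ← intervalIntegral.integral_of_le hS.le, intervalIntegral.integral_const_mul,
      integral_sub_rpow_mul_rpow hS (hμ j) hν]
    field_simp
  have hsumm : Summable fun j => ∫ s in Ioc 0 S, ‖F j s‖ := by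
    refine ((summable_pow_div_Gamma hα (add_pos hα hν) (|c| * S ^ α)).mul_left
      (|c| * S ^ (α + ν - 1) * Real.Gamma ν)).congr fun j => ?_
    rw [hnorm j, mul_pow, ← Real.rpow_mul_natCast hS.le,
      show ((j : ℝ) + 1) * α + ν - 1 = α * j + (α + ν - 1) by ring, Real.rpow_add hS,
      show (j : ℝ) * α + (α + ν) = (j + 1) * α + ν by ring]
    ring
  rw [hFsum]
  refine ⟨(intervalIntegrable_iff_integrableOn_Ioc_of_le hS.le).2
    (integrable_tsum_of_summable_integral_norm hmeas hint hsumm), ?_⟩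
  rw [intervalIntegral.integral_of_le hS.le,
    ← (hasSum_integral_of_summable_integral_norm hint hsumm).tsum_eq]
  exact tsum_congr hval

theorem summable_mittagLeffler {α : ℝ} (hα : 0 < α) (x : ℝ) :
    Summable fun j : ℕ => x ^ j / Real.Gamma (j * α + 1) :=
  summable_pow_div_Gamma hα one_pos x

theorem mittagLeffler_zero {α : ℝ} : mittagLeffler α 0 = 1 := by
  rw [mittagLeffler, tsum_eq_single 0 fun j hj => by simp [hj]]
  simp

theorem integral_mittagLefflerDeriv {α S : ℝ} (hα : 0 < α) (hS : 0 < S) (c : ℝ) :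
    IntervalIntegrable (mittagLefflerDeriv α c) volume 0 S ∧
    mittagLeffler α (c * S ^ α) = 1 + ∫ s in (0 : ℝ)..S, mittagLefflerDeriv α c s := by
  obtain ⟨h1, h2⟩ := integral_sub_rpow_mul_mittagLefflerDeriv hα one_pos hS c
  simp only [sub_self, Real.rpow_zero, one_mul] at h1 h2
  refine ⟨h1, ?_⟩
  rw [h2, mittagLeffler, (summable_mittagLeffler hα _).tsum_eq_zero_add]
  congr 1
  · simp
  · refine tsum_congr fun j => ?_
    rw [mul_pow, ← Real.rpow_mul_natCast hS.le, Real.Gamma_one, mul_one, add_sub_cancel_right,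
      mul_comm α]
    push_cast
    rfl

/-- Up to the factor `Γ(1 - α)`, this is the eigenfunction equation `D^α E = c E` for `E(s) = E_α(c
s^α)`. -/
theorem integral_rpow_neg_mul_mittagLefflerDeriv {α S : ℝ} (hα : 0 < α) (hα1 : α < 1) (hS : 0 < S)
    (c : ℝ) :
    IntervalIntegrable (fun s => (S - s) ^ (-α) * mittagLefflerDeriv α c s) volume 0 S ∧
    ∫ s in (0 : ℝ)..S, (S - s) ^ (-α) * mittagLefflerDeriv α c s =
      c * Real.Gamma (1 - α) * mittagLeffler α (c * S ^ α) := by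
  have h := integral_sub_rpow_mul_mittagLefflerDeriv hα (sub_pos.2 hα1) hS c
  rw [show 1 - α - 1 = -α by ring] at h
  refine ⟨h.1, ?_⟩
  rw [h.2, mittagLeffler, ← tsum_mul_left]
  refine tsum_congr fun j => ?_
  rw [mul_pow, ← Real.rpow_mul_natCast hS.le, show ((j : ℝ) + 1) * α + (1 - α) = j * α + 1 by ring,
    show (j : ℝ) * α + 1 - 1 = α * j by ring]
  ring

theorem mittagLeffler_one (x : ℝ) : mittagLeffler 1 x = Real.exp x := by
  rw [mittagLeffler, Real.exp_eq_exp_ℝ, NormedSpace.exp_eq_tsum_div]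
  exact tsum_congr fun j => by rw [mul_one, Real.Gamma_nat_eq_factorial]

/-! ### The time change by `ψ` and the comparison principle -/

section Clock

variable {ψ : ℝ → ℝ} {ℓ : ℝ}

theorem hasDerivAt_of_contDiffOn_Ici (hψ : ContDiffOn ℝ 1 ψ (Ici ℓ)) {t : ℝ} (ht : ℓ < t) :
    HasDerivAt ψ (derivWithin ψ (Ici ℓ) t) t :=
  ((hψ.differentiableOn one_ne_zero t ht.le).hasDerivWithinAt).hasDerivAt (Ici_mem_nhds ht)

theorem strictMonoOn_of_derivWithin_pos (hψ : ContDiffOn ℝ 1 ψ (Ici ℓ))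
    (hψ_pos : ∀ t, ℓ ≤ t → 0 < derivWithin ψ (Ici ℓ) t) : StrictMonoOn ψ (Ici ℓ) := by
  refine strictMonoOn_of_deriv_pos (convex_Ici ℓ) hψ.continuousOn fun t ht => ?_
  rw [interior_Ici] at ht
  rw [(hasDerivAt_of_contDiffOn_Ici hψ ht).deriv]
  exact hψ_pos t (le_of_lt ht)

/-- Only integrability of `h` is available, since it may be singular at both ends; hence the change
of variables for injective maps, on the open interval. -/
theorem integral_derivWithin_mul_comp_sub (hψ : ContDiffOn ℝ 1 ψ (Ici ℓ))
    (hψ_pos : ∀ t, ℓ ≤ t → 0 < derivWithin ψ (Ici ℓ) t) {t : ℝ} (ht : ℓ < t) {h : ℝ → ℝ}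
    (hh : IntervalIntegrable h volume 0 (ψ t - ψ ℓ)) :
    IntervalIntegrable (fun τ => derivWithin ψ (Ici ℓ) τ * h (ψ τ - ψ ℓ)) volume ℓ t ∧
    ∫ τ in ℓ..t, derivWithin ψ (Ici ℓ) τ * h (ψ τ - ψ ℓ) = ∫ s in (0 : ℝ)..(ψ t - ψ ℓ), h s := by
  have hmono := strictMonoOn_of_derivWithin_pos hψ hψ_pos
  have hS : 0 < ψ t - ψ ℓ := sub_pos.2 (hmono self_mem_Ici ht.le ht)
  set f : ℝ → ℝ := fun τ => ψ τ - ψ ℓ with hf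
  have hsub : Ioo ℓ t ⊆ Ici ℓ := fun τ hτ => hτ.1.le
  have himage : f '' Ioo ℓ t = Ioo 0 (ψ t - ψ ℓ) := by
    apply Subset.antisymm
    · rintro _ ⟨τ, hτ, rfl⟩
      exact ⟨sub_pos.2 (hmono self_mem_Ici hτ.1.le hτ.1),
        sub_lt_sub_right (hmono hτ.1.le ht.le hτ.2) _⟩
    · have hc : ContinuousOn f (Icc ℓ t) :=
        (hψ.continuousOn.mono Icc_subset_Ici_self).sub continuousOn_const
      simpa [hf] using intermediate_value_Ioo ht.le hc
  have hderiv : ∀ τ ∈ Ioo ℓ t, HasDerivWithinAt f (derivWithin ψ (Ici ℓ) τ) (Ioo ℓ t) τ :=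
    fun τ hτ => ((hasDerivAt_of_contDiffOn_Ici hψ hτ.1).sub_const _).hasDerivWithinAt
  have hinj : InjOn f (Ioo ℓ t) := fun a ha b hb hab =>
    hmono.injOn (hsub ha) (hsub hb) (sub_left_injective hab)
  have habs : ∀ τ ∈ Ioo ℓ t, |derivWithin ψ (Ici ℓ) τ| • h (f τ) =
      derivWithin ψ (Ici ℓ) τ * h (ψ τ - ψ ℓ) := fun τ hτ => by
    rw [abs_of_pos (hψ_pos τ hτ.1.le), smul_eq_mul]
  constructor
  · rw [intervalIntegrable_iff_integrableOn_Ioo_of_le ht.le,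
      ← integrableOn_congr_fun habs measurableSet_Ioo,
      ← integrableOn_image_iff_integrableOn_abs_deriv_smul measurableSet_Ioo hderiv hinj, himage]
    exact (intervalIntegrable_iff_integrableOn_Ioo_of_le hS.le).1 hh
  · rw [intervalIntegral.integral_of_le ht.le, integral_Ioc_eq_integral_Ioo,
      ← setIntegral_congr_fun measurableSet_Ioo habs,
      ← integral_image_eq_integral_abs_deriv_smul measurableSet_Ioo hderiv hinj, himage,
      intervalIntegral.integral_of_le hS.le, integral_Ioc_eq_integral_Ioo]

theorem absolutelyContinuousOnInterval_rpow_neg (hψ : ContDiffOn ℝ 1 ψ (Ici ℓ))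
    (hψ_pos : ∀ t, ℓ ≤ t → 0 < derivWithin ψ (Ici ℓ) t) (α t : ℝ) :
    ∀ b ∈ Ioo ℓ t, AbsolutelyContinuousOnInterval (fun τ => (ψ t - ψ τ) ^ (-α)) ℓ b := by
  intro b hb
  have hmono := strictMonoOn_of_derivWithin_pos hψ hψ_pos
  apply ContDiffOn.absolutelyContinuousOnInterval
  rw [uIcc_of_le hb.1.le]
  refine (contDiffOn_const.sub (hψ.mono Icc_subset_Ici_self)).rpow_const_of_ne fun τ hτ => ?_
  exact (sub_pos.2 (hmono hτ.1 (hb.1.le.trans hb.2.le) (hτ.2.trans_lt hb.2))).ne'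

theorem monotoneOn_rpow_neg (hψ : ContDiffOn ℝ 1 ψ (Ici ℓ))
    (hψ_pos : ∀ t, ℓ ≤ t → 0 < derivWithin ψ (Ici ℓ) t) {α : ℝ} (hα : 0 < α) (t : ℝ) :
    MonotoneOn (fun τ => (ψ t - ψ τ) ^ (-α)) (Ico ℓ t) := by
  have hmono := strictMonoOn_of_derivWithin_pos hψ hψ_pos
  intro a ha b hb hab
  refine Real.rpow_le_rpow_of_nonpos (sub_pos.2 (hmono hb.1 (hb.1.trans hb.2.le) hb.2)) ?_
    (neg_nonpos.2 hα.le)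
  exact sub_le_sub_left (hmono.monotoneOn ha.1 hb.1 hab) _

theorem rpow_neg_sub_pos (hψ : ContDiffOn ℝ 1 ψ (Ici ℓ))
    (hψ_pos : ∀ t, ℓ ≤ t → 0 < derivWithin ψ (Ici ℓ) t) (α t : ℝ) :
    ∀ τ ∈ Ico ℓ t, 0 < (ψ t - ψ τ) ^ (-α) := fun _ hτ =>
  Real.rpow_pos_of_pos (sub_pos.2 (strictMonoOn_of_derivWithin_pos hψ hψ_pos hτ.1
    (hτ.1.trans hτ.2.le) hτ.2)) _

/-- A fractional comparison principle: absolutely continuous subsolutions of `ᶜD^α V = c V` with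
`c ≤ 0` are dominated by the Mittag-Leffler solution with the same initial value. -/
theorem le_mul_mittagLeffler_of_integral_le (hψ : ContDiffOn ℝ 1 ψ (Ici ℓ))
    (hψ_pos : ∀ t, ℓ ≤ t → 0 < derivWithin ψ (Ici ℓ) t) {α c : ℝ} (hα : 0 < α) (hα1 : α < 1)
    (hc : c ≤ 0) {V : ℝ → ℝ} (hV : ∀ T, ℓ ≤ T → AbsolutelyContinuousOnInterval V ℓ T)
    (hint : ∀ t, ℓ < t →
      IntervalIntegrable (fun τ => (ψ t - ψ τ) ^ (-α) * deriv V τ) volume ℓ t)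
    (hle : ∀ t, ℓ < t →
      ∫ τ in ℓ..t, (ψ t - ψ τ) ^ (-α) * deriv V τ ≤ c * Real.Gamma (1 - α) * V t)
    {T : ℝ} (hT : ℓ ≤ T) :
    V T ≤ V ℓ * mittagLeffler α (c * (ψ T - ψ ℓ) ^ α) := by
  have hmono := strictMonoOn_of_derivWithin_pos hψ hψ_pos
  have hS : ∀ {t}, ℓ < t → 0 < ψ t - ψ ℓ := fun {t} ht =>
    sub_pos.2 (hmono self_mem_Ici (le_of_lt ht) ht)
  have hΓ : 0 < Real.Gamma (1 - α) := Real.Gamma_pos_of_pos (sub_pos.2 hα1)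
  set G : ℝ → ℝ := fun τ => derivWithin ψ (Ici ℓ) τ * mittagLefflerDeriv α c (ψ τ - ψ ℓ) with hG
  -- Defining the Mittag-Leffler solution as a primitive makes its absolute continuity immediate,
  -- although its derivative may blow up at `ℓ`.
  set w : ℝ → ℝ := fun t => V ℓ * (1 + ∫ τ in ℓ..t, G τ) with hw
  have hGint : ∀ t, ℓ < t → IntervalIntegrable G volume ℓ t := fun t ht =>
    (integral_derivWithin_mul_comp_sub hψ hψ_pos ht
      (integral_mittagLefflerDeriv hα (hS ht) c).1).1
  have hwℓ : w ℓ = V ℓ := by simp [hw]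
  have hwE : ∀ t, ℓ < t → w t = V ℓ * mittagLeffler α (c * (ψ t - ψ ℓ) ^ α) := fun t ht => by
    have h := integral_mittagLefflerDeriv hα (hS ht) c
    rw [h.2, ← (integral_derivWithin_mul_comp_sub hψ hψ_pos ht h.1).2]
  have hwAC : ∀ t, ℓ < t → AbsolutelyContinuousOnInterval w ℓ t := fun t ht =>
    ((contDiffOn_const.absolutelyContinuousOnInterval).fun_add
      ((hGint t ht).absolutelyContinuousOnInterval_intervalIntegral left_mem_uIcc)).const_mul _
  have hwderiv : ∀ t, ℓ < t → ∀ᵐ τ, τ ∈ uIcc ℓ t → deriv w τ = V ℓ * G τ := fun t ht => by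
    filter_upwards [(hGint t ht).ae_hasDerivAt_integral] with τ hτ hmem
    exact (((hτ hmem ℓ left_mem_uIcc).const_add 1).const_mul _).deriv
  have hkw : ∀ t, ℓ < t →
      IntervalIntegrable (fun τ => (ψ t - ψ τ) ^ (-α) * (V ℓ * G τ)) volume ℓ t ∧
      ∫ τ in ℓ..t, (ψ t - ψ τ) ^ (-α) * (V ℓ * G τ) = c * Real.Gamma (1 - α) * w t := fun t ht => by
    obtain ⟨h1, h2⟩ := integral_rpow_neg_mul_mittagLefflerDeriv hα hα1 (hS ht) c
    obtain ⟨h3, h4⟩ := integral_derivWithin_mul_comp_sub hψ hψ_pos ht h1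
    have heq : (fun τ => (ψ t - ψ τ) ^ (-α) * (V ℓ * G τ)) = fun τ => V ℓ *
        (derivWithin ψ (Ici ℓ) τ * ((ψ t - ψ ℓ - (ψ τ - ψ ℓ)) ^ (-α) *
          mittagLefflerDeriv α c (ψ τ - ψ ℓ))) := by
      funext τ
      rw [sub_sub_sub_cancel_right]
      simp only [hG]
      ring
    rw [heq]
    refine ⟨h3.const_mul _, ?_⟩
    rw [intervalIntegral.integral_const_mul, h4, h2, hwE t ht]
    ring
  rcases hT.eq_or_lt with rfl | hT'
  · rw [sub_self, Real.zero_rpow hα.ne', mul_zero, mittagLeffler_zero, mul_one]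
  rw [← hwE T hT']
  by_contra! hlt
  set u : ℝ → ℝ := fun t => V t - w t with hu
  have huAC : ∀ t, ℓ < t → AbsolutelyContinuousOnInterval u ℓ t := fun t ht =>
    (hV t ht.le).fun_sub (hwAC t ht)
  have hcont : ContinuousOn u (Icc ℓ T) := by
    simpa only [uIcc_of_le hT] using (huAC T hT').continuousOn
  -- The maximum over `[ℓ, T]` may be interior, but `t` is the right endpoint of `[ℓ, t]`, which is
  -- all the extremum principle needs.
  obtain ⟨t, ht, hmax⟩ := isCompact_Icc.exists_isMaxOn (nonempty_Icc.2 hT) hcont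
  have hut : 0 < u t := (sub_pos.2 hlt).trans_le (hmax (right_mem_Icc.2 hT))
  have huℓ : u ℓ = 0 := by simp only [hu, hwℓ, sub_self]
  have htℓ : ℓ < t := ht.1.lt_of_ne fun h => by rw [← h, huℓ] at hut; exact hut.false
  have hderiv : ∀ᵐ τ, τ ∈ uIoc ℓ t →
      (ψ t - ψ τ) ^ (-α) * deriv V τ - (ψ t - ψ τ) ^ (-α) * (V ℓ * G τ) =
        (ψ t - ψ τ) ^ (-α) * deriv u τ := by
    filter_upwards [hwderiv t htℓ, (hV t htℓ.le).ae_differentiableAt,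
      (hwAC t htℓ).ae_differentiableAt] with τ h1 h2 h3 hmem
    have hmem' := uIoc_subset_uIcc hmem
    rw [((h2 hmem').hasDerivAt.fun_sub (h3 hmem').hasDerivAt).deriv, h1 hmem', mul_sub]
  have hprinciple := mul_sub_le_integral_mul_deriv_of_isMax htℓ
    (absolutelyContinuousOnInterval_rpow_neg hψ hψ_pos α t) (monotoneOn_rpow_neg hψ hψ_pos hα t)
    (fun τ hτ => (rpow_neg_sub_pos hψ hψ_pos α t τ hτ).le) (huAC t htℓ)
    (fun τ hτ => hmax ⟨hτ.1, hτ.2.trans ht.2⟩)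
    (((hint t htℓ).sub (hkw t htℓ).1).congr_ae ((ae_restrict_iff' measurableSet_uIoc).2 hderiv))
  rw [← intervalIntegral.integral_congr_ae hderiv,
    intervalIntegral.integral_sub (hint t htℓ) (hkw t htℓ).1, (hkw t htℓ).2, huℓ,
    sub_zero] at hprinciple
  have hpos := mul_pos (rpow_neg_sub_pos hψ hψ_pos α t ℓ ⟨le_rfl, htℓ⟩) hut
  have hneg : c * Real.Gamma (1 - α) * u t ≤ 0 :=
    mul_nonpos_of_nonpos_of_nonneg (mul_nonpos_of_nonpos_of_nonneg hc hΓ.le) hut.le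
  have := hle t htℓ
  simp only [hu] at hneg
  linarith

end Clock

/-! ### Strong convexity and the descent lemma -/

section Gradient

variable {d : ℕ} {f : EuclideanSpace ℝ (Fin d) → ℝ}

theorem differentiable_gradient (hf : ContDiff ℝ 2 f) : Differentiable ℝ (gradient f) := by
  have h : Differentiable ℝ (fderiv ℝ f) :=
    (hf.fderiv_right (m := 1) (by norm_num)).differentiable one_ne_zero
  exact (InnerProductSpace.toDual ℝ (EuclideanSpace ℝ (Fin d))).symm.differentiable.comp h

theorem hasDerivAt_add_smul (y h : EuclideanSpace ℝ (Fin d)) (s : ℝ) :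
    HasDerivAt (fun s : ℝ => y + s • h) h s := by
  simpa using ((hasDerivAt_id s).smul_const h).const_add y

/-- Along the segment `y + s h`, the Hessian bound makes `⟪∇f(y + s h), h⟫ - s m ‖h‖²`
nondecreasing; compare `s = 0` and `s = 1`. -/
theorem mul_norm_sq_le_inner_gradient (hf : ContDiff ℝ 2 f) {m : ℝ}
    (hf_hess : ∀ x v, m * inner ℝ v v ≤ inner ℝ (hessian f x v) v)
    {y : EuclideanSpace ℝ (Fin d)} (hy : gradient f y = 0) (x : EuclideanSpace ℝ (Fin d)) :
    m * ‖x - y‖ ^ 2 ≤ inner ℝ (x - y) (gradient f x) := by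
  set h := x - y with hh
  have hderiv : ∀ s : ℝ, HasDerivAt (fun s : ℝ => inner ℝ (gradient f (y + s • h)) h -
      s * (m * inner ℝ h h)) (inner ℝ (hessian f (y + s • h) h) h - m * inner ℝ h h) s := by
    intro s
    have h1 : HasDerivAt (fun s : ℝ => gradient f (y + s • h)) (hessian f (y + s • h) h) s :=
      ((differentiable_gradient hf _).hasFDerivAt).comp_hasDerivAt s (hasDerivAt_add_smul y h s)
    have h2 := h1.inner ℝ (hasDerivAt_const s h)
    have h3 := (hasDerivAt_id s).mul_const (m * inner ℝ h h)
    simpa using! h2.sub h3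
  have hmono := monotone_of_deriv_nonneg (fun s => (hderiv s).differentiableAt) fun s => by
    rw [(hderiv s).deriv]
    exact sub_nonneg.2 (hf_hess _ _)
  have h01 := hmono zero_le_one
  simp only [zero_smul, add_zero, one_smul, hy, inner_zero_left, zero_mul, sub_zero, one_mul] at h01
  rw [hh, add_sub_cancel, ← hh, real_inner_self_eq_norm_sq, real_inner_comm] at h01
  linarith

/-- Since `∇f y = 0`, Cauchy-Schwarz gives `⟪∇f(y + s h), h⟫ ≤ s M ‖h‖²`, so `f(y + s h) - s² M ‖h‖²
/ 2` is nonincreasing on `[0, 1]`. -/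
theorem sub_le_of_lipschitz_gradient (hf : ContDiff ℝ 2 f) {M : ℝ}
    (hM : ∀ x₁ x₂, ‖gradient f x₁ - gradient f x₂‖ ≤ M * ‖x₁ - x₂‖)
    {y : EuclideanSpace ℝ (Fin d)} (hy : gradient f y = 0) (x : EuclideanSpace ℝ (Fin d)) :
    f x - f y ≤ 1 / 2 * M * ‖x - y‖ ^ 2 := by
  set h := x - y with hh
  have hderiv : ∀ s : ℝ, HasDerivAt (fun s : ℝ => f (y + s • h) - s ^ 2 * (1 / 2 * M * ‖h‖ ^ 2))
      (inner ℝ (gradient f (y + s • h)) h - s * (M * ‖h‖ ^ 2)) s := by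
    intro s
    have h0 : HasGradientAt f (gradient f (y + s • h)) (y + s • h) :=
      (hf.differentiable two_ne_zero _).hasGradientAt
    have h1 := h0.hasFDerivAt.comp_hasDerivAt s (hasDerivAt_add_smul y h s)
    have h3 := (hasDerivAt_pow 2 s).mul_const (1 / 2 * M * ‖h‖ ^ 2)
    convert! h1.sub h3 using 1
    simp
    ring
  have hanti : AntitoneOn (fun s : ℝ => f (y + s • h) - s ^ 2 * (1 / 2 * M * ‖h‖ ^ 2))
      (Icc 0 1) := by
    refine antitoneOn_of_deriv_nonpos (convex_Icc 0 1)
      (fun s _ => (hderiv s).continuousAt.continuousWithinAt)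
      (fun s _ => (hderiv s).differentiableAt.differentiableWithinAt) fun s hs => ?_
    rw [interior_Icc] at hs
    rw [(hderiv s).deriv, sub_nonpos]
    have hMs := hM (y + s • h) y
    rw [hy, sub_zero, add_sub_cancel_left, norm_smul, Real.norm_of_nonneg hs.1.le] at hMs
    calc inner ℝ (gradient f (y + s • h)) h ≤ ‖gradient f (y + s • h)‖ * ‖h‖ :=
          real_inner_le_norm _ _
      _ ≤ M * (s * ‖h‖) * ‖h‖ := mul_le_mul_of_nonneg_right hMs (norm_nonneg _)
      _ = _ := by ring
  have h01 := hanti (left_mem_Icc.2 zero_le_one) (right_mem_Icc.2 zero_le_one) zero_le_one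
  simp only [zero_smul, add_zero, one_smul] at h01
  rw [hh, add_sub_cancel, ← hh] at h01
  linarith

end Gradient

/-! ### From components to the squared norm -/

theorem _root_.AbsolutelyContinuousOnInterval.euclidean_apply {d : ℕ}
    {z : ℝ → EuclideanSpace ℝ (Fin d)} {a b : ℝ} (hz : AbsolutelyContinuousOnInterval z a b)
    (i : Fin d) :
    AbsolutelyContinuousOnInterval (fun s => z s i) a b := by
  rw [absolutelyContinuousOnInterval_iff] at hz ⊢
  intro ε hε
  obtain ⟨δ, hδ, h⟩ := hz ε hε
  refine ⟨δ, hδ, fun E hE hlen => (Finset.sum_le_sum fun j _ => ?_).trans_lt (h E hE hlen)⟩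
  rw [dist_eq_norm, dist_eq_norm]
  exact PiLp.norm_apply_le (z (E.2 j).1 - z (E.2 j).2) i

theorem absolutelyContinuousOnInterval_fun_sum {ι : Type*} (s : Finset ι) {v : ι → ℝ → ℝ} {a b : ℝ}
    (hv : ∀ i ∈ s, AbsolutelyContinuousOnInterval (v i) a b) :
    AbsolutelyContinuousOnInterval (fun x => ∑ i ∈ s, v i x) a b := by
  classical
  induction s using Finset.induction_on with
  | empty => simpa using (contDiffOn_const (c := (0 : ℝ))).absolutelyContinuousOnInterval
  | insert i s hi ih =>
    simp only [Finset.sum_insert hi]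
    exact (hv i (Finset.mem_insert_self i s)).fun_add
      (ih fun j hj => hv j (Finset.mem_insert_of_mem hj))

theorem integral_mul_deriv_sum {ι : Type*} (s : Finset ι) {k : ℝ → ℝ} {v : ι → ℝ → ℝ} {a b : ℝ}
    (hv : ∀ i ∈ s, AbsolutelyContinuousOnInterval (v i) a b)
    (hint : ∀ i ∈ s, IntervalIntegrable (fun x => k x * deriv (v i) x) volume a b) :
    IntervalIntegrable (fun x => k x * deriv (fun y => ∑ i ∈ s, v i y) x) volume a b ∧
    ∫ x in a..b, k x * deriv (fun y => ∑ i ∈ s, v i y) x =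
      ∑ i ∈ s, ∫ x in a..b, k x * deriv (v i) x := by
  have hae : ∀ᵐ x, x ∈ uIoc a b →
      ∑ i ∈ s, k x * deriv (v i) x = k x * deriv (fun y => ∑ i ∈ s, v i y) x := by
    have hdiff : ∀ᵐ x, ∀ i ∈ s, x ∈ uIcc a b → DifferentiableAt ℝ (v i) x :=
      (Filter.eventually_all_finset s).2 fun i hi => (hv i hi).ae_differentiableAt
    filter_upwards [hdiff] with x hx hmem
    rw [deriv_fun_sum fun i hi => hx i hi (uIoc_subset_uIcc hmem), Finset.mul_sum]
  have hsum : IntervalIntegrable (fun x => ∑ i ∈ s, k x * deriv (v i) x) volume a b := by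
    have h := IntervalIntegrable.sum s hint
    rw [Finset.sum_fn] at h
    exact h
  refine ⟨hsum.congr_ae ((ae_restrict_iff' measurableSet_uIoc).2 hae), ?_⟩
  rw [← intervalIntegral.integral_congr_ae hae, intervalIntegral.integral_finsetSum hint]

/-- The weight `ψ'` of the kernel cancels the `1 / ψ'` in `J_ψ`. -/
theorem psiKernel_psiJ_eq {ψ : ℝ → ℝ} {ℓ : ℝ}
    (hψ_pos : ∀ t, ℓ ≤ t → 0 < derivWithin ψ (Ici ℓ) t) (α : ℝ) (x : ℝ → ℝ) {t τ : ℝ}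
    (hτ : ℓ < τ) :
    psiKernel ψ ℓ (1 - α) (psiJ ψ ℓ x) t τ = (ψ t - ψ τ) ^ (-α) * deriv x τ := by
  rw [psiKernel, psiJ, derivWithin_of_mem_nhds (f := x) (Ici_mem_nhds hτ), mul_assoc,
    mul_inv_cancel_left₀ (hψ_pos τ hτ.le).ne', show 1 - α - 1 = -α by ring]

theorem psiCaputo_eq_of_lt_one {ψ : ℝ → ℝ} {ℓ α : ℝ}
    (hψ_pos : ∀ t, ℓ ≤ t → 0 < derivWithin ψ (Ici ℓ) t) (hα1 : α < 1) (x : ℝ → ℝ) {t : ℝ}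
    (ht : ℓ < t) (hx : PsiCaputoExistsAt ψ ℓ α x t) :
    IntervalIntegrable (fun τ => (ψ t - ψ τ) ^ (-α) * deriv x τ) volume ℓ t ∧
    ∫ τ in ℓ..t, (ψ t - ψ τ) ^ (-α) * deriv x τ =
      Real.Gamma (1 - α) * psiCaputo ψ ℓ α x t := by
  have hcongr : EqOn (psiKernel ψ ℓ (1 - α) (psiJ ψ ℓ x) t)
      (fun τ => (ψ t - ψ τ) ^ (-α) * deriv x τ) (uIoc ℓ t) := fun τ hτ => by
    rw [uIoc_of_le ht.le] at hτ
    exact psiKernel_psiJ_eq hψ_pos α x hτ.1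
  refine ⟨(hx.2 hα1.ne).congr hcongr, ?_⟩
  rw [psiCaputo, psiIntegral, if_neg (sub_pos.2 hα1).ne',
    mul_inv_cancel_left₀ (Real.Gamma_pos_of_pos (sub_pos.2 hα1)).ne']
  exact (intervalIntegral.integral_congr_ae (ae_of_all _ hcongr)).symm

/-- The field enters only through the dissipativity bound `hg`, which turns Alikhanov's inequality
into `D^α V ≤ lam V`. -/
theorem IsCaputoSolution.norm_sub_sq_le {d : ℕ} {ψ : ℝ → ℝ} {α ℓ lam : ℝ}
    {g : EuclideanSpace ℝ (Fin d) → EuclideanSpace ℝ (Fin d)}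
    {y z₀ : EuclideanSpace ℝ (Fin d)} {z : ℝ → EuclideanSpace ℝ (Fin d)}
    (hz : IsCaputoSolution ψ ℓ α g z₀ z) (hα : 0 < α) (hα1 : α ≤ 1)
    (hψ : ContDiffOn ℝ 1 ψ (Ici ℓ)) (hψ_pos : ∀ t, ℓ ≤ t → 0 < derivWithin ψ (Ici ℓ) t)
    (hlam : lam ≤ 0) (hg : ∀ x, 2 * inner ℝ (x - y) (g x) ≤ lam * ‖x - y‖ ^ 2)
    {t : ℝ} (ht : ℓ ≤ t) :
    ‖z t - y‖ ^ 2 ≤ ‖z₀ - y‖ ^ 2 * mittagLeffler α (lam * (ψ t - ψ ℓ) ^ α) := by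
  have hinner : ∀ x, ∑ i, 2 * (x i - y i) * g x i = 2 * inner ℝ (x - y) (g x) := fun x => by
    rw [PiLp.inner_apply, Finset.mul_sum]
    refine Finset.sum_congr rfl fun i _ => ?_
    simp
    ring
  have hV : ∀ s, ‖z s - y‖ ^ 2 = ∑ i, (z s i - y i) ^ 2 := fun s => by
    rw [EuclideanSpace.norm_sq_eq]
    simp
  rw [← hz.initial]
  rcases hα1.lt_or_eq with hα1 | rfl
  · have hx : ∀ i T, ℓ ≤ T → AbsolutelyContinuousOnInterval (fun s => z s i - y i) ℓ T :=
      fun i T hT => ((hz.absolutelyContinuous T hT).euclidean_apply i).fun_sub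
        contDiffOn_const.absolutelyContinuousOnInterval
    have hx2 : ∀ i T, ℓ ≤ T → AbsolutelyContinuousOnInterval (fun s => (z s i - y i) ^ 2) ℓ T :=
      fun i T hT => by simpa only [sq] using (hx i T hT).fun_mul (hx i T hT)
    have hsq : ∀ s, ℓ < s → ∀ i,
        IntervalIntegrable
          (fun τ => (ψ s - ψ τ) ^ (-α) * deriv (fun r => (z r i - y i) ^ 2) τ) volume ℓ s ∧
        ∫ τ in ℓ..s, (ψ s - ψ τ) ^ (-α) * deriv (fun r => (z r i - y i) ^ 2) τ ≤
          2 * (z s i - y i) * (Real.Gamma (1 - α) * g (z s) i) := fun s hs i => by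
      obtain ⟨h1, h2⟩ := psiCaputo_eq_of_lt_one hψ_pos hα1 (fun r => z r i) hs (hz.existsAt s hs i)
      have heq : psiCaputo ψ ℓ α (fun r => z r i) s = g (z s) i := by
        rw [← hz.equation s hs]
        rfl
      rw [← heq, ← h2]
      have h := integral_mul_deriv_sq_le (u := fun r => z r i - y i) hs
        (absolutelyContinuousOnInterval_rpow_neg hψ hψ_pos α s)
        (monotoneOn_rpow_neg hψ hψ_pos hα s)
        (fun τ hτ => (rpow_neg_sub_pos hψ hψ_pos α s τ hτ).le) (hx i s hs.le)
        (by simpa only [deriv_sub_const] using h1)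
      simpa only [deriv_sub_const] using h
    have hΓ : 0 < Real.Gamma (1 - α) := Real.Gamma_pos_of_pos (sub_pos.2 hα1)
    simp only [hV]
    refine le_mul_mittagLeffler_of_integral_le (V := fun s => ∑ i, (z s i - y i) ^ 2) hψ hψ_pos hα
      hα1 hlam (fun T hT => absolutelyContinuousOnInterval_fun_sum _ fun i _ => hx2 i T hT)
      (fun s hs => (integral_mul_deriv_sum _ (fun i _ => hx2 i s hs.le)
        fun i _ => (hsq s hs i).1).1) (fun s hs => ?_) ht
    rw [(integral_mul_deriv_sum _ (fun i _ => hx2 i s hs.le) fun i _ => (hsq s hs i).1).2]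
    calc ∑ i, ∫ τ in ℓ..s, (ψ s - ψ τ) ^ (-α) * deriv (fun r => (z r i - y i) ^ 2) τ
        ≤ ∑ i, 2 * (z s i - y i) * (Real.Gamma (1 - α) * g (z s) i) :=
          Finset.sum_le_sum fun i _ => (hsq s hs i).2
      _ = Real.Gamma (1 - α) * ∑ i, 2 * (z s i - y i) * g (z s) i := by
          rw [Finset.mul_sum]
          exact Finset.sum_congr rfl fun i _ => by ring
      _ ≤ Real.Gamma (1 - α) * (lam * ‖z s - y‖ ^ 2) := by
          rw [hinner]
          exact mul_le_mul_of_nonneg_left (hg _) hΓ.le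
      _ = _ := by rw [hV]; ring
  -- For `α = 1` the equation reads `z' = ψ' g(z)` and `E_1 = exp`; the quantity `V exp(-lam (ψ - ψ
  -- ℓ))` is nonincreasing.
  · have hderiv : ∀ s, ℓ < s → ∀ i, HasDerivAt (fun r => z r i)
        (derivWithin ψ (Ici ℓ) s * g (z s) i) s := fun s hs i => by
      have h := (((hz.existsAt s hs i).1 rfl).hasDerivWithinAt).hasDerivAt (Ici_mem_nhds hs)
      refine h.congr_deriv (Eq.symm ?_)
      rw [← hz.equation s hs]
      change _ * psiCaputo ψ ℓ 1 (fun r => z r i) s = _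
      rw [psiCaputo, psiIntegral, if_pos (sub_self 1), psiJ,
        mul_inv_cancel_left₀ (hψ_pos s hs.le).ne']
    have hW : ∀ s, ℓ < s → HasDerivAt
        (fun r => (∑ i, (z r i - y i) ^ 2) * Real.exp (-(lam * (ψ r - ψ ℓ))))
        ((derivWithin ψ (Ici ℓ) s * (2 * inner ℝ (z s - y) (g (z s)) - lam * ‖z s - y‖ ^ 2)) *
          Real.exp (-(lam * (ψ s - ψ ℓ)))) s := fun s hs => by
      have h1 := HasDerivAt.fun_sum fun i (_ : i ∈ Finset.univ) =>
        ((hderiv s hs i).sub_const (y i)).fun_pow 2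
      have h2 := ((((hasDerivAt_of_contDiffOn_Ici hψ hs).sub_const (ψ ℓ)).const_mul
        lam).fun_neg).exp
      convert! h1.mul h2 using 1
      have h3 : ∑ i, ((2 : ℕ) : ℝ) * (z s i - y i) ^ (2 - 1) *
          (derivWithin ψ (Ici ℓ) s * g (z s) i) =
          derivWithin ψ (Ici ℓ) s * (2 * inner ℝ (z s - y) (g (z s))) := by
        rw [← hinner, Finset.mul_sum]
        refine Finset.sum_congr rfl fun i _ => ?_
        push_cast
        ring
      rw [h3, hV]
      ring
    have hzcont : ∀ i, ContinuousOn (fun r => z r i) (Icc ℓ t) := fun i => by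
      simpa only [uIcc_of_le ht] using
        ((hz.absolutelyContinuous t ht).euclidean_apply i).continuousOn
    have hψcont : ContinuousOn ψ (Icc ℓ t) := hψ.continuousOn.mono Icc_subset_Ici_self
    have hanti : AntitoneOn
        (fun r => (∑ i, (z r i - y i) ^ 2) * Real.exp (-(lam * (ψ r - ψ ℓ)))) (Icc ℓ t) := by
      refine antitoneOn_of_deriv_nonpos (convex_Icc ℓ t) (by fun_prop) (fun s hs => ?_)
        fun s hs => ?_
      · rw [interior_Icc] at hs
        exact (hW s hs.1).differentiableAt.differentiableWithinAt
      · rw [interior_Icc] at hs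
        rw [(hW s hs.1).deriv]
        exact mul_nonpos_of_nonpos_of_nonneg (mul_nonpos_of_nonneg_of_nonpos
          (hψ_pos s hs.1.le).le (sub_nonpos.2 (hg _))) (Real.exp_pos _).le
    have h := hanti (left_mem_Icc.2 ht) (right_mem_Icc.2 ht) ht
    simp only [sub_self, mul_zero, neg_zero, Real.exp_zero, mul_one, ← hV] at h
    rw [mittagLeffler_one, Real.rpow_one]
    rwa [Real.exp_neg, ← div_eq_mul_inv, div_le_iff₀ (Real.exp_pos _)] at h

end PsiFractional

/-! ### The convergence estimates -/

theorem theorem1 {d : ℕ} (f : EuclideanSpace ℝ (Fin d) → ℝ) (ψ : ℝ → ℝ) (α ℓ β m : ℝ)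
    (hα_pos : 0 < α) (hα_le : α ≤ 1) (hβ : 0 ≤ β)
    (hf : ContDiff ℝ 2 f) (hm : 0 < m)
    (hf_hess : ∀ x v : EuclideanSpace ℝ (Fin d),
      m * inner ℝ v v ≤ inner ℝ (PsiFractional.hessian f x v) v)
    (hψ : ContDiffOn ℝ 1 ψ (Set.Ici ℓ)) (hψ_pos : ∀ t, ℓ ≤ t → 0 < derivWithin ψ (Set.Ici ℓ) t)
    (y z₀ : EuclideanSpace ℝ (Fin d)) (hy : gradient f y = 0)
    (z : ℝ → EuclideanSpace ℝ (Fin d))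
    (hz : PsiFractional.IsCaputoSolution ψ ℓ α (fun x => -β • gradient f x) z₀ z) :
    (∀ t, ℓ ≤ t →
      ‖z t - y‖ ^ 2 ≤
        ‖z₀ - y‖ ^ 2 * PsiFractional.mittagLeffler α (-β * m * (ψ t - ψ ℓ) ^ α)) ∧
    (∀ M : ℝ, (∀ x₁ x₂, ‖gradient f x₁ - gradient f x₂‖ ≤ M * ‖x₁ - x₂‖) →
      ∀ t, ℓ ≤ t →
        f (z t) - f y ≤
          1 / 2 * M * ‖z₀ - y‖ ^ 2 *
            PsiFractional.mittagLeffler α (-β * m * (ψ t - ψ ℓ) ^ α)) := by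
  have hbound : ∀ t, ℓ ≤ t → ‖z t - y‖ ^ 2 ≤
      ‖z₀ - y‖ ^ 2 * PsiFractional.mittagLeffler α (-β * m * (ψ t - ψ ℓ) ^ α) := by
    intro t ht
    have hβm := mul_nonneg hβ hm.le
    refine hz.norm_sub_sq_le hα_pos hα_le hψ hψ_pos (by linarith) (fun x => ?_) ht
    have h1 := mul_le_mul_of_nonneg_left
      (PsiFractional.mul_norm_sq_le_inner_gradient hf hf_hess hy x) hβ
    -- Strong convexity yields the rate `2βm`; this nonnegative term gives away half of it.
    have h2 := mul_nonneg hβm (sq_nonneg ‖x - y‖)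
    rw [inner_smul_right]
    linarith
  refine ⟨hbound, fun M hM t ht => ?_⟩
  have hdescent := PsiFractional.sub_le_of_lipschitz_gradient hf hM hy (z t)
  -- `0 ≤ M` is forced by the Lipschitz bound only if two distinct points exist; for `d = 0` both
  -- sides vanish.
  rcases subsingleton_or_nontrivial (EuclideanSpace ℝ (Fin d)) with hs | hs
  · rw [Subsingleton.elim (z t) y, Subsingleton.elim z₀ y]
    simp
  · obtain ⟨x₁, x₂, hne⟩ := exists_pair_ne (EuclideanSpace ℝ (Fin d))
    have hM0 : 0 ≤ M :=
      nonneg_of_mul_nonneg_left ((norm_nonneg _).trans (hM x₁ x₂))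
        (norm_pos_iff.2 (sub_ne_zero.2 hne))
    have := mul_le_mul_of_nonneg_left (hbound t ht) (by positivity : 0 ≤ 1 / 2 * M)
    linarith
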